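/- For positive integers $i_1,\dots,i_k$ with $i_1\ge 2$ let $$\zeta(i_1,\dots,i_k)=\sum_{n_1>n_2>\cdots>n_k>0}\frac{1}{n_1^{i_1}\cdots n_k^{i_k}},\qquad t(i_1,\dots,i_k)=\sum_{\substack{n_1>n_2>\cdots>n_k>0\\ \text{all } n_j \text{ odd}}}\frac{1}{n_1^{i_1}\cdots n_k^{i_k}}$$ be the multiple zeta value and the multiple $t$-value, and let $\zeta(s)$ be the Riemann zeta function. Write $(3,\{2\}^n)$ for the index $(3,2,\dots,2)$ with $n$ entries equal to $2$. For an integer $n\ge 0$ let $\mathbf{Q}[\pi,\zeta(3),\zeta(5),\dots,\zeta(2n+3)]_{2n+3}$ denote the set of all numbers $P(\pi,\zeta(3),\zeta(5),\dots,\zeta(2n+3))$, where $P\in\mathbf{Q}[x_0,x_1,\dots,x_{n+1}]$ is zero or homogeneous of degree $2n+3$ with respect to the grading $\deg x_0=1$, $\deg x_j=2j+1$ $(1\le j\le n+1)$; that is, $\pi$ has degree $1$ and $\zeta(2j+1)$ has degree $2j+1$. Then for every integer $n\ge 0$ the series defining $\zeta(3,\{2\}^n)$ and $t(3,\{2\}^n)$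 converge, and $$\frac{\zeta(3,\{2\}^n)}{2^{2n+3}}\in \mathbf{Q}[\pi,\zeta(3),\zeta(5),\dots,\zeta(2n+3)]_{2n+3} \quad\text{and}\quad t(3,\{2\}^n)\in \mathbf{Q}[\pi,\zeta(3),\zeta(5),\dots,\zeta(2n+3)]_{2n+3}.$$ -/

import Mathlib

/-- The summand `1 / (n₁ ^ i₁ ⋯ n_k ^ i_k)`. -/
noncomputable def multipleTerm {k : ℕ} (i n : Fin k → ℕ) : ℝ :=
  1 / ∏ j, (n j : ℝ) ^ i j

/-- The range of summation `n₁ > n₂ > ⋯ > n_k > 0` of a multiple zeta value. -/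
def zetaRange (k : ℕ) : Set (Fin k → ℕ) :=
  {n | StrictAnti n ∧ ∀ j, 0 < n j}

/-- The range of summation `n₁ > n₂ > ⋯ > n_k > 0`, all `n_j` odd, of a multiple `t`-value. -/
def tRange (k : ℕ) : Set (Fin k → ℕ) :=
  {n | StrictAnti n ∧ ∀ j, Odd (n j)}

/-- The multiple zeta value `ζ(i₁, …, i_k)` (for positive `i_j` with `i₁ ≥ 2`). -/
noncomputable def multipleZeta {k : ℕ} (i : Fin k → ℕ) : ℝ :=
  ∑' n : zetaRange k, multipleTerm i n

/-- The multiple `t`-value `t(i₁, …, i_k)` (for positive `i_j` with `i₁ ≥ 2`). -/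
noncomputable def multipleT {k : ℕ} (i : Fin k → ℕ) : ℝ :=
  ∑' n : tRange k, multipleTerm i n

/-- The multi-index `(3, 2, …, 2)` with `n` entries equal to `2`. -/
def threeTwos (n : ℕ) : Fin (n + 1) → ℕ :=
  Fin.cons 3 (fun _ : Fin n => 2)

/-- The numbers `π, ζ(3), ζ(5), …, ζ(2N+1)`: entry `0` is `π`, and entry `j ≥ 1` is `ζ(2j+1)`. -/
noncomputable def piOddZeta (N : ℕ) (j : Fin (N + 1)) : ℂ :=
  if j = 0 then (Real.pi : ℂ) else riemannZeta (2 * (j : ℕ) + 1)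

/-- The degrees of the generators: `1` for `π` (entry `0`) and `2j+1` for `ζ(2j+1)`. -/
def piOddZetaDegree (N : ℕ) (j : Fin (N + 1)) : ℕ :=
  2 * (j : ℕ) + 1

/-- `ℚ[π, ζ(3), ζ(5), …, ζ(2N+1)]_d`: all values at `π, ζ(3), …, ζ(2N+1)` of the rational
polynomials that are homogeneous of degree `d`, where `π` has degree `1` and `ζ(2j+1)` has
degree `2j+1`. -/
noncomputable def piOddZetaPart (N d : ℕ) : Submodule ℚ ℂ :=
  (MvPolynomial.weightedHomogeneousSubmodule ℚ (piOddZetaDegree N) d).map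
    (MvPolynomial.aeval (R := ℚ) (piOddZeta N)).toLinearMap

/-! Write `S_p` for `sinPow p` and `T f(θ) = ∫₀^θ (θ - x) f(x) dx`. The second derivative of `sin ^
(p+2)` gives `T S_p = S_{p+2} / (p+2)² + T S_{p+2}`, hence `T S_p = ∑_{j≥1} S_{p+2j} / (p+2j)²` on
`[0, π/2)`. Starting from `θ²/2` (even indices) or `θ` (odd indices) and applying `T` repeatedly,
`θ^m / m!` becomes a series in the `S_p` whose coefficients are sums of `∏ 1/p_j²` over decreasing
chains starting at `p` (`tsum_chainSum_mul_sinPow`).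

Integration against `(π/2 - x) cot x` turns `S_p` into `c / p`, where `c` is `π/2` for even and `1`
for odd `p`; this supplies the third power of the leading entry. So `(π/2) ζ(3,{2}^n) / 2^(2n+3)`
and `t(3,{2}^n)` equal `∫₀^{π/2} (x^m / m!) (π/2 - x) cot x dx` with `m = 2n+2` and `m = 2n+1`
respectively (`tsum_chainSum_div`). All terms are nonnegative, so working in `ℝ≥0∞` makes every
interchange free and yields convergence at the end.

The polynomial factor vanishes at `0` and `π/2`. Expanding `cot x = 2 ∑ sin 2kx` and integrating by
parts leaves only the sums of `1/k^s` and `(-1)^k/k^s` with `s` odd, `s ≥ 3`: rational multiples of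
`ζ(s)` times powers of `π` (`exists_integral_scaledPoly_mul_cot`). -/

open MeasureTheory Set Filter Topology
open scoped ENNReal

/-! ### Normalised sine powers and double integration -/

/-- The normalising factors `λ_p` that make `λ_p ∫₀^{π/2} sin^p` depend only on the parity
of `p`. -/
noncomputable def sinWeight : ℕ → ℝ
  | 0 => 1
  | 1 => 1
  | p + 2 => sinWeight p * ((p + 2) / (p + 1))

lemma sinWeight_pos : ∀ p, 0 < sinWeight p
  | 0 => by simp [sinWeight]
  | 1 => by simp [sinWeight]
  | p + 2 => by
    have := sinWeight_pos p
    rw [sinWeight]; positivity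

lemma sinWeight_le : ∀ p : ℕ, sinWeight p ≤ p + 1
  | 0 => by simp [sinWeight]
  | 1 => by simp [sinWeight]
  | p + 2 => by
    have := sinWeight_le p
    rw [sinWeight, ← mul_div_assoc, div_le_iff₀ (by positivity)]
    push_cast
    nlinarith

/-- The normalised sine powers. -/
noncomputable def sinPow (p : ℕ) (x : ℝ) : ℝ := sinWeight p * Real.sin x ^ p

@[fun_prop]
lemma continuous_sinPow (p : ℕ) : Continuous (sinPow p) := by
  unfold sinPow; fun_prop

lemma sinPow_nonneg (p : ℕ) {x : ℝ} (h0 : 0 ≤ x) (h1 : x ≤ Real.pi) : 0 ≤ sinPow p x :=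
  mul_nonneg (sinWeight_pos p).le (pow_nonneg (Real.sin_nonneg_of_nonneg_of_le_pi h0 h1) _)

/-- For `F = sin ^ (p+2)` one has `F'' = (p+2)(p+1) sin^p - (p+2)² sin^(p+2)`, and `(θ - x) F' + F`
is a primitive of `(θ - x) F''`. -/
lemma integral_sub_mul_sin_pow (θ : ℝ) (p : ℕ) :
    (p + 2) * (p + 1) * ∫ x in (0 : ℝ)..θ, (θ - x) * Real.sin x ^ p =
      Real.sin θ ^ (p + 2) +
        (p + 2) ^ 2 * ∫ x in (0 : ℝ)..θ, (θ - x) * Real.sin x ^ (p + 2) := by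
  have h : ∀ x ∈ uIcc 0 θ, HasDerivAt
      (fun x => (θ - x) * ((p + 2) * (Real.sin x ^ (p + 1) * Real.cos x)) + Real.sin x ^ (p + 2))
      ((p + 2) * (p + 1) * ((θ - x) * Real.sin x ^ p) -
        (p + 2) ^ 2 * ((θ - x) * Real.sin x ^ (p + 2))) x := by
    intro x _
    have h1 := ((hasDerivAt_id x).const_sub θ)
    have h2 := ((((Real.hasDerivAt_sin x).pow (p + 1)).mul (Real.hasDerivAt_cos x)).const_mul
      ((p : ℝ) + 2))
    have h3 := (Real.hasDerivAt_sin x).pow (p + 2)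
    refine ((h1.mul h2).add h3).congr_deriv ?_
    have hc : Real.cos x ^ 2 = 1 - Real.sin x ^ 2 := Real.cos_sq' x
    simp only [id, Nat.add_sub_cancel, show p + 2 - 1 = p + 1 by omega]
    push_cast
    simp only [Pi.pow_apply, Pi.mul_apply]
    linear_combination ((θ - x) * (p + 2) * (p + 1) * Real.sin x ^ p) * hc
  have := intervalIntegral.integral_eq_sub_of_hasDerivAt h
    (Continuous.intervalIntegrable (by fun_prop) _ _)
  rw [intervalIntegral.integral_sub (Continuous.intervalIntegrable (by fun_prop) _ _)
    (Continuous.intervalIntegrable (by fun_prop) _ _), intervalIntegral.integral_const_mul,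
    intervalIntegral.integral_const_mul] at this
  simp at this
  linarith

lemma integral_sub_mul_sinPow (θ : ℝ) (p : ℕ) :
    ∫ x in (0 : ℝ)..θ, (θ - x) * sinPow p x =
      sinPow (p + 2) θ / (p + 2) ^ 2 + ∫ x in (0 : ℝ)..θ, (θ - x) * sinPow (p + 2) x := by
  have h := integral_sub_mul_sin_pow θ p
  have e : ∀ q, ∫ x in (0 : ℝ)..θ, (θ - x) * sinPow q x =
      sinWeight q * ∫ x in (0 : ℝ)..θ, (θ - x) * Real.sin x ^ q := fun q => by
    rw [← intervalIntegral.integral_const_mul]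
    simp only [sinPow]; congr 1; ext x; ring
  rw [e, e, sinPow, sinWeight]
  have : (p : ℝ) + 1 ≠ 0 := by positivity
  have : (p : ℝ) + 2 ≠ 0 := by positivity
  field_simp
  linear_combination sinWeight p * h

/-- The weights grow at most linearly, while `sin x ≤ sin θ < 1` makes the powers decay
geometrically. This is the remainder of the telescoped recursion. -/
lemma tendsto_integral_sub_mul_sinPow {θ : ℝ} (h0 : 0 ≤ θ) (h1 : θ < Real.pi / 2) (p : ℕ) :
    Tendsto (fun N : ℕ => ∫ x in (0 : ℝ)..θ, (θ - x) * sinPow (p + 2 * N) x) atTop (𝓝 0) := by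
  have hpi := Real.pi_pos
  set r := Real.sin θ with hr
  have hr0 : 0 ≤ r := Real.sin_nonneg_of_nonneg_of_le_pi h0 (by linarith)
  have hr1 : r < 1 := by
    rw [hr, ← Real.sin_pi_div_two]
    exact Real.sin_lt_sin_of_lt_of_le_pi_div_two (by linarith) le_rfl h1
  have key : Tendsto (fun q : ℕ => θ * (((q : ℝ) + 1) * r ^ q) * θ) atTop (𝓝 0) := by
    have a := tendsto_self_mul_const_pow_of_lt_one hr0 hr1
    have b := tendsto_pow_atTop_nhds_zero_of_lt_one hr0 hr1
    have := (((a.add b).const_mul θ).mul_const θ)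
    simp only [add_zero, mul_zero, zero_mul] at this
    refine this.congr fun q => by ring
  have hN : Tendsto (fun N : ℕ => p + 2 * N) atTop atTop :=
    tendsto_atTop_mono (fun N => show N ≤ p + 2 * N by omega) tendsto_id
  refine squeeze_zero (fun N => ?_) (fun N => ?_) (key.comp hN)
  · refine intervalIntegral.integral_nonneg h0 fun x hx => mul_nonneg (by linarith [hx.2]) ?_
    exact sinPow_nonneg _ hx.1 (by linarith [hx.2])
  · have := intervalIntegral.integral_mono_on (f := fun x => (θ - x) * sinPow (p + 2 * N) x)
      (g := fun _ => θ * ((((p + 2 * N : ℕ) : ℝ) + 1) * r ^ (p + 2 * N))) (μ := volume) h0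
      (Continuous.intervalIntegrable (by fun_prop) _ _)
      (Continuous.intervalIntegrable (by fun_prop) _ _) (fun x hx => ?_)
    · refine this.trans (le_of_eq ?_)
      rw [intervalIntegral.integral_const, smul_eq_mul, Function.comp]
      ring
    · have hs : 0 ≤ Real.sin x := Real.sin_nonneg_of_nonneg_of_le_pi hx.1 (by linarith [hx.2])
      have hs' : Real.sin x ≤ r :=
        Real.sin_le_sin_of_le_of_le_pi_div_two (by linarith [hx.1]) h1.le hx.2
      refine mul_le_mul (by linarith [hx.1]) ?_ (sinPow_nonneg _ hx.1 (by linarith [hx.2])) h0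
      exact mul_le_mul (sinWeight_le _) (pow_le_pow_left₀ hs hs' _) (pow_nonneg hs _)
        (by positivity)

lemma hasSum_sinPow {θ : ℝ} (h0 : 0 ≤ θ) (h1 : θ < Real.pi / 2) (p : ℕ) :
    HasSum (fun j : ℕ => sinPow (p + 2 * (j + 1)) θ / ((p + 2 * (j + 1) : ℕ) : ℝ) ^ 2)
      (∫ x in (0 : ℝ)..θ, (θ - x) * sinPow p x) := by
  have hpi := Real.pi_pos
  rw [hasSum_iff_tendsto_nat_of_nonneg
    (fun j => div_nonneg (sinPow_nonneg _ h0 (by linarith)) (by positivity))]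
  have e : ∀ N : ℕ, ∑ j ∈ Finset.range N,
      sinPow (p + 2 * (j + 1)) θ / ((p + 2 * (j + 1) : ℕ) : ℝ) ^ 2 =
      (∫ x in (0 : ℝ)..θ, (θ - x) * sinPow p x) -
        ∫ x in (0 : ℝ)..θ, (θ - x) * sinPow (p + 2 * N) x := by
    intro N
    induction N with
    | zero => simp
    | succ N ih =>
      have := integral_sub_mul_sinPow θ (p + 2 * N)
      rw [Finset.sum_range_succ, ih, this, show p + 2 * (N + 1) = p + 2 * N + 2 by ring]
      push_cast
      ring
  have := (tendsto_integral_sub_mul_sinPow h0 h1 p).const_sub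
    (∫ x in (0 : ℝ)..θ, (θ - x) * sinPow p x)
  rw [sub_zero] at this
  exact this.congr fun N => (e N).symm

lemma lintegral_Ioo_eq_intervalIntegral {f : ℝ → ℝ} {a b : ℝ} (hab : a ≤ b)
    (hf : IntegrableOn f (Ioo a b)) (h : ∀ x ∈ Ioo a b, 0 ≤ f x) :
    ∫⁻ x in Ioo a b, ENNReal.ofReal (f x) = ENNReal.ofReal (∫ x in a..b, f x) := by
  rw [intervalIntegral.integral_of_le hab, integral_Ioc_eq_integral_Ioo,
    ofReal_integral_eq_lintegral_ofReal hf]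
  exact (ae_restrict_iff' measurableSet_Ioo).2 (ae_of_all _ h)

lemma Continuous.integrableOn_Ioo' {f : ℝ → ℝ} (hf : Continuous f) (a b : ℝ) :
    IntegrableOn f (Ioo a b) :=
  (hf.integrableOn_Icc (a := a) (b := b)).mono_set Ioo_subset_Icc_self

/-- The squared reciprocals of the numbers `2 i + ε`. -/
noncomputable def invSq (ε i : ℕ) : ℝ≥0∞ := ENNReal.ofReal (1 / ((2 * i + ε : ℕ) : ℝ) ^ 2)

lemma lintegral_sub_mul_sinPow {θ : ℝ} (h0 : 0 ≤ θ) (h1 : θ < Real.pi / 2) (ε j : ℕ) :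
    ∫⁻ x in Ioo 0 θ, ENNReal.ofReal (θ - x) * ENNReal.ofReal (sinPow (2 * j + ε) x) =
      ∑' i, if j < i then invSq ε i * ENNReal.ofReal (sinPow (2 * i + ε) θ) else 0 := by
  have hpi := Real.pi_pos
  have hs := hasSum_sinPow h0 h1 (2 * j + ε)
  have nn : ∀ q, 0 ≤ sinPow q θ := fun q => sinPow_nonneg q h0 (by linarith)
  have inj : Function.Injective (fun l : ℕ => j + l + 1) := fun a b h => by
    simp only at h; omega
  rw [← inj.tsum_eq]
  · calc _ = ∫⁻ x in Ioo 0 θ, ENNReal.ofReal ((θ - x) * sinPow (2 * j + ε) x) :=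
          setLIntegral_congr_fun measurableSet_Ioo fun x hx =>
            (ENNReal.ofReal_mul (by linarith [hx.2])).symm
      _ = _ := by
          rw [lintegral_Ioo_eq_intervalIntegral h0
            (Continuous.integrableOn_Ioo' (by fun_prop) _ _)
            (fun x hx => mul_nonneg (by linarith [hx.2])
              (sinPow_nonneg _ hx.1.le (by linarith [hx.2]))), ← hs.tsum_eq,
            ENNReal.ofReal_tsum_of_nonneg (fun i => div_nonneg (nn _) (by positivity)) hs.summable]
          refine tsum_congr fun l => ?_
          rw [if_pos (by omega), invSq, ← ENNReal.ofReal_mul (by positivity),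
            show 2 * j + ε + 2 * (l + 1) = 2 * (j + l + 1) + ε by ring]
          congr 1; ring
  · intro i hi
    have : j < i := by
      by_contra h
      simp [h] at hi
    exact ⟨i - j - 1, by simp only; omega⟩

/-! ### Chain sums as coefficients of `θ^m / m!` -/

/-- The sum of `∏ g` over the strictly decreasing chains of length `n + 1` that start at `p`. -/
noncomputable def chainSum (g : ℕ → ℝ≥0∞) : ℕ → ℕ → ℝ≥0∞
  | 0, p => g p
  | n + 1, p => g p * ∑' q, if q < p then chainSum g n q else 0

lemma integral_sub_mul_pow (θ : ℝ) (d : ℕ) :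
    ∫ x in (0 : ℝ)..θ, (θ - x) * (x ^ d / d.factorial) = θ ^ (d + 2) / (d + 2).factorial := by
  have h : ∀ x ∈ uIcc 0 θ, HasDerivAt (fun x : ℝ => (θ / (d + 1) * x ^ (d + 1) -
      1 / (d + 2) * x ^ (d + 2)) / d.factorial) ((θ - x) * (x ^ d / d.factorial)) x := by
    intro x _
    refine ((((hasDerivAt_pow (d + 1) x).const_mul (θ / (d + 1))).sub
      ((hasDerivAt_pow (d + 2) x).const_mul (1 / ((d : ℝ) + 2)))).div_const _).congr_deriv ?_
    have : (d : ℝ) + 1 ≠ 0 := by positivity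
    have : (d : ℝ) + 2 ≠ 0 := by positivity
    simp only [Nat.add_sub_cancel, show d + 2 - 1 = d + 1 by omega]
    push_cast
    field_simp
    ring
  rw [intervalIntegral.integral_eq_sub_of_hasDerivAt h
    (Continuous.intervalIntegrable (by fun_prop) _ _)]
  have : (d : ℝ) + 1 ≠ 0 := by positivity
  have : (d : ℝ) + 2 ≠ 0 := by positivity
  have : (d.factorial : ℝ) ≠ 0 := by positivity
  rw [Nat.factorial_succ, Nat.factorial_succ]
  push_cast
  simp only [zero_pow (Nat.succ_ne_zero _)]
  field_simp
  ring

/-- Each application of `T` raises the power of `θ` by two and prepends a new largest entry to every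
chain; Tonelli exchanges the sums and the integral. -/
lemma tsum_chainSum_mul_sinPow {ε d : ℕ}
    (hbase : ∀ θ, 0 < θ → θ < Real.pi / 2 →
      ∑' i, invSq ε i * ENNReal.ofReal (sinPow (2 * i + ε) θ) =
        ENNReal.ofReal (θ ^ d / d.factorial)) (n : ℕ) :
    ∀ θ, 0 < θ → θ < Real.pi / 2 →
      ∑' i, chainSum (invSq ε) n i * ENNReal.ofReal (sinPow (2 * i + ε) θ) =
        ENNReal.ofReal (θ ^ (2 * n + d) / (2 * n + d).factorial) := by
  induction n with
  | zero => simpa [chainSum] using hbase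
  | succ n ih =>
    intro θ h0 h1
    have step : ∫⁻ x in Ioo 0 θ, ENNReal.ofReal (θ - x) *
        ENNReal.ofReal (x ^ (2 * n + d) / (2 * n + d).factorial) =
        ENNReal.ofReal (θ ^ (2 * (n + 1) + d) / (2 * (n + 1) + d).factorial) := by
      rw [show 2 * (n + 1) + d = 2 * n + d + 2 by ring, ← integral_sub_mul_pow,
        ← lintegral_Ioo_eq_intervalIntegral h0.le (Continuous.integrableOn_Ioo' (by fun_prop) _ _)
          (fun x hx => mul_nonneg (by linarith [hx.2])
            (div_nonneg (pow_nonneg hx.1.le _) (by positivity)))]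
      exact setLIntegral_congr_fun measurableSet_Ioo fun x hx =>
            (ENNReal.ofReal_mul (by linarith [hx.2])).symm
    rw [← step]
    calc _ = ∑' i, ∑' j, if j < i then
            chainSum (invSq ε) n j * (invSq ε i * ENNReal.ofReal (sinPow (2 * i + ε) θ)) else 0 := by
          refine tsum_congr fun i => ?_
          rw [chainSum, mul_right_comm, ← ENNReal.tsum_mul_left]
          refine tsum_congr fun j => ?_
          split_ifs <;> simp [mul_comm]
      _ = ∑' j, ∑' i, if j < i then
            chainSum (invSq ε) n j * (invSq ε i * ENNReal.ofReal (sinPow (2 * i + ε) θ)) else 0 :=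
          ENNReal.tsum_comm
      _ = ∑' j, chainSum (invSq ε) n j * ∫⁻ x in Ioo 0 θ,
            ENNReal.ofReal (θ - x) * ENNReal.ofReal (sinPow (2 * j + ε) x) := by
          refine tsum_congr fun j => ?_
          rw [lintegral_sub_mul_sinPow h0.le h1, ← ENNReal.tsum_mul_left]
          refine tsum_congr fun i => ?_
          split_ifs <;> simp
      _ = ∫⁻ x in Ioo 0 θ, ∑' j, chainSum (invSq ε) n j *
            (ENNReal.ofReal (θ - x) * ENNReal.ofReal (sinPow (2 * j + ε) x)) := by
          rw [lintegral_tsum fun j => Measurable.aemeasurable (by fun_prop)]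
          exact tsum_congr fun j => (lintegral_const_mul _ (by fun_prop)).symm
      _ = _ := by
          refine setLIntegral_congr_fun measurableSet_Ioo fun x hx => ?_
          rw [← ih x hx.1 (by linarith [hx.2]), ← ENNReal.tsum_mul_left]
          exact tsum_congr fun j => by ring

lemma tsum_invSq_zero (θ : ℝ) (h0 : 0 < θ) (h1 : θ < Real.pi / 2) :
    ∑' i, invSq 0 i * ENNReal.ofReal (sinPow (2 * i + 0) θ) =
      ENNReal.ofReal (θ ^ 2 / Nat.factorial 2) := by
  have := lintegral_sub_mul_sinPow h0.le h1 0 0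
  have h2 := integral_sub_mul_pow θ 0
  rw [show θ ^ 2 / (Nat.factorial 2 : ℝ) = ∫ x in (0 : ℝ)..θ, (θ - x) from by simpa using h2.symm,
    ← lintegral_Ioo_eq_intervalIntegral h0.le (Continuous.integrableOn_Ioo' (by fun_prop) _ _)
          (fun x hx => by linarith [hx.2])]
  refine Eq.trans (tsum_congr fun i => ?_) (this.symm.trans ?_)
  -- The term `i = 0` is absent from `T 1`; here it vanishes because `1 / 0 = 0`.
  · rcases Nat.eq_zero_or_pos i with rfl | hi
    · simp [invSq]
    · simp [hi]
  · simp [sinPow, sinWeight]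

lemma tsum_invSq_one (θ : ℝ) (h0 : 0 < θ) (h1 : θ < Real.pi / 2) :
    ∑' i, invSq 1 i * ENNReal.ofReal (sinPow (2 * i + 1) θ) =
      ENNReal.ofReal (θ ^ 1 / Nat.factorial 1) := by
  have hpi := Real.pi_pos
  have hs := hasSum_sinPow h0.le h1 1
  have nn : ∀ q, 0 ≤ sinPow q θ := fun q => sinPow_nonneg q h0.le (by linarith)
  -- The sine missing from `T sin` is exactly the term `i = 0` of the series for `θ`.
  have hI : ∫ x in (0 : ℝ)..θ, (θ - x) * sinPow 1 x = θ - Real.sin θ := by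
    have h : ∀ x ∈ uIcc 0 θ, HasDerivAt (fun x : ℝ => -((θ - x) * Real.cos x) - Real.sin x)
        ((θ - x) * sinPow 1 x) x := by
      intro x _
      refine (((((hasDerivAt_id x).const_sub θ).mul (Real.hasDerivAt_cos x)).neg).sub
        (Real.hasDerivAt_sin x)).congr_deriv ?_
      simp [sinPow, sinWeight]
    rw [intervalIntegral.integral_eq_sub_of_hasDerivAt h
      (Continuous.intervalIntegrable (by fun_prop) _ _)]
    simp
    ring
  rw [hI] at hs
  have h' : HasSum (fun i : ℕ => 1 / ((2 * i + 1 : ℕ) : ℝ) ^ 2 * sinPow (2 * i + 1) θ) θ := by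
    rw [← hasSum_nat_add_iff' 1]
    have e1 : (fun j : ℕ => 1 / ((2 * (j + 1) + 1 : ℕ) : ℝ) ^ 2 * sinPow (2 * (j + 1) + 1) θ) =
        fun j : ℕ => sinPow (1 + 2 * (j + 1)) θ / ((1 + 2 * (j + 1) : ℕ) : ℝ) ^ 2 := by
      ext j
      rw [show 1 + 2 * (j + 1) = 2 * (j + 1) + 1 by ring]; ring
    rw [e1]
    simpa [sinPow, sinWeight] using hs
  rw [show θ ^ 1 / (Nat.factorial 1 : ℝ) = θ by simp]
  conv_rhs => rw [← h'.tsum_eq]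
  rw [ENNReal.ofReal_tsum_of_nonneg (fun i => mul_nonneg (by positivity) (nn _)) h'.summable]
  exact tsum_congr fun i => (ENNReal.ofReal_mul (by positivity)).symm

/-! ### Integration against the cotangent weight -/

/-- The weight against which the normalised sine powers are integrated. -/
noncomputable def cotWeight (x : ℝ) : ℝ := (Real.pi / 2 - x) * (Real.cos x / Real.sin x)

@[fun_prop]
lemma measurable_cotWeight : Measurable cotWeight := by unfold cotWeight; fun_prop

lemma cotWeight_nonneg {x : ℝ} (hx : x ∈ Ioo 0 (Real.pi / 2)) : 0 ≤ cotWeight x := by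
  have := Real.pi_pos
  exact mul_nonneg (by linarith [hx.2]) (div_nonneg
    (Real.cos_nonneg_of_mem_Icc ⟨by linarith [hx.1], hx.2.le⟩)
    (Real.sin_nonneg_of_nonneg_of_le_pi hx.1.le (by linarith [hx.2])))

lemma integral_sinPow_zero_pi_div_two (ε i : ℕ) :
    ∫ x in (0 : ℝ)..(Real.pi / 2), sinPow (2 * i + ε) x =
      ∫ x in (0 : ℝ)..(Real.pi / 2), sinPow ε x := by
  induction i with
  | zero => simp
  | succ i ih =>
    rw [← ih, show 2 * (i + 1) + ε = 2 * i + ε + 2 by ring]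
    generalize 2 * i + ε = p
    simp only [sinPow, intervalIntegral.integral_const_mul, integral_sin_pow, sinWeight]
    have : (p : ℝ) + 1 ≠ 0 := by positivity
    have : (p : ℝ) + 2 ≠ 0 := by positivity
    simp
    field_simp

/-- Up to the factor `1 / (p+1)`, `sin^(p+1) cot` is the derivative of `sin^(p+1)`; in the
integration by parts the factor `π/2 - x` removes the boundary term at `π/2`. -/
lemma lintegral_sinPow_mul_cotWeight (p : ℕ) :
    ∫⁻ x in Ioo 0 (Real.pi / 2), ENNReal.ofReal (sinPow (p + 1) x) * ENNReal.ofReal (cotWeight x) =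
      ENNReal.ofReal ((∫ x in (0 : ℝ)..(Real.pi / 2), sinPow (p + 1) x) / ((p + 1 : ℕ) : ℝ)) := by
  have hpi := Real.pi_pos
  have h : ∀ x ∈ uIcc 0 (Real.pi / 2), HasDerivAt
      (fun x : ℝ => (Real.pi / 2 - x) * Real.sin x ^ (p + 1))
      ((p + 1) * ((Real.pi / 2 - x) * (Real.sin x ^ p * Real.cos x)) - Real.sin x ^ (p + 1)) x := by
    intro x _
    refine (((hasDerivAt_id x).const_sub _).mul ((Real.hasDerivAt_sin x).pow (p + 1))).congr_deriv ?_
    simp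
    ring
  have h2 := intervalIntegral.integral_eq_sub_of_hasDerivAt h
    (Continuous.intervalIntegrable (by fun_prop) _ _)
  rw [intervalIntegral.integral_sub (Continuous.intervalIntegrable (by fun_prop) _ _)
    (Continuous.intervalIntegrable (by fun_prop) _ _), intervalIntegral.integral_const_mul] at h2
  have hp : (p : ℝ) + 1 ≠ 0 := by positivity
  have h3 : (∫ x in (0 : ℝ)..(Real.pi / 2), sinPow (p + 1) x) / ((p + 1 : ℕ) : ℝ) =
      ∫ x in (0 : ℝ)..(Real.pi / 2),
        sinWeight (p + 1) * ((Real.pi / 2 - x) * (Real.sin x ^ p * Real.cos x)) := by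
    simp only [sinPow, intervalIntegral.integral_const_mul]
    simp at h2
    rw [div_eq_iff (by positivity)]
    push_cast
    linear_combination (-sinWeight (p + 1)) * h2
  rw [h3, ← lintegral_Ioo_eq_intervalIntegral (by positivity)
    (Continuous.integrableOn_Ioo' (by fun_prop) _ _)]
  · refine setLIntegral_congr_fun measurableSet_Ioo fun x hx => ?_
    have hs : 0 < Real.sin x := Real.sin_pos_of_pos_of_lt_pi hx.1 (by linarith [hx.2])
    rw [← ENNReal.ofReal_mul (sinPow_nonneg _ hx.1.le (by linarith [hx.2]))]
    congr 1
    rw [sinPow, cotWeight]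
    field_simp
    ring
  · intro x hx
    have hs : 0 < Real.sin x := Real.sin_pos_of_pos_of_lt_pi hx.1 (by linarith [hx.2])
    have hc : 0 ≤ Real.cos x := Real.cos_nonneg_of_mem_Icc ⟨by linarith [hx.1], hx.2.le⟩
    have := sinWeight_pos (p + 1)
    have : 0 ≤ Real.pi / 2 - x := by linarith [hx.2]
    positivity

/-- `∑ a_i / (2 i + ε)` over the chain sums `a_i`, as an integral. -/
lemma tsum_chainSum_div {ε d : ℕ} {c : ℝ} (hc : 0 ≤ c)
    (hci : ∫ x in (0 : ℝ)..(Real.pi / 2), sinPow ε x = c)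
    (hbase : ∀ θ, 0 < θ → θ < Real.pi / 2 →
      ∑' i, invSq ε i * ENNReal.ofReal (sinPow (2 * i + ε) θ) =
        ENNReal.ofReal (θ ^ d / d.factorial)) (n : ℕ) (h00 : chainSum (invSq ε) n 0 = 0 ∨ ε ≠ 0) :
    ENNReal.ofReal c *
        ∑' i, ENNReal.ofReal (1 / ((2 * i + ε : ℕ) : ℝ)) * chainSum (invSq ε) n i =
      ∫⁻ x in Ioo 0 (Real.pi / 2), ENNReal.ofReal (x ^ (2 * n + d) / (2 * n + d).factorial) *
        ENNReal.ofReal (cotWeight x) := by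
  calc _ = ∑' i, chainSum (invSq ε) n i * ∫⁻ x in Ioo 0 (Real.pi / 2),
        ENNReal.ofReal (sinPow (2 * i + ε) x) * ENNReal.ofReal (cotWeight x) := by
        rw [← ENNReal.tsum_mul_left]
        refine tsum_congr fun i => ?_
        -- The integral formula needs a positive exponent; at exponent `0` the chain sum itself
        -- vanishes.
        by_cases hi : 2 * i + ε = 0
        · obtain ⟨rfl, rfl⟩ : i = 0 ∧ ε = 0 := by omega
          rcases h00 with h | h
          · simp [h]
          · exact absurd rfl h
        · obtain ⟨p, hp⟩ := Nat.exists_eq_succ_of_ne_zero hi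
          have e := integral_sinPow_zero_pi_div_two ε i
          rw [hp, Nat.succ_eq_add_one] at *
          rw [lintegral_sinPow_mul_cotWeight, e, hci, ← mul_assoc, ← ENNReal.ofReal_mul hc,
            mul_one_div, mul_comm]
    _ = ∫⁻ x in Ioo 0 (Real.pi / 2), ∑' i, chainSum (invSq ε) n i *
          (ENNReal.ofReal (sinPow (2 * i + ε) x) * ENNReal.ofReal (cotWeight x)) := by
        rw [lintegral_tsum fun j => Measurable.aemeasurable (by fun_prop)]
        exact tsum_congr fun j => (lintegral_const_mul _ (by fun_prop)).symm
    _ = _ := by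
        refine setLIntegral_congr_fun measurableSet_Ioo fun x hx => ?_
        rw [← tsum_chainSum_mul_sinPow hbase n x hx.1 hx.2, ← ENNReal.tsum_mul_right]
        exact tsum_congr fun j => by ring

/-! ### Cotangent integrals of polynomials -/

lemma tendsto_integral_mul_cos_odd {f : ℝ → ℝ} (hf : Integrable f) :
    Tendsto (fun N : ℕ => ∫ x, f x * Real.cos ((2 * N + 1) * x)) atTop (𝓝 0) := by
  have hpi := Real.pi_pos
  have h := Real.tendsto_integral_exp_smul_cocompact (fun x => (f x : ℂ))
  -- Riemann–Lebesgue with the character `exp (2πi ·)`: angular frequency `2N+1` means `w = (2N+1) /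
  -- (2π)`.
  have hw : Tendsto (fun N : ℕ => (2 * (N : ℝ) + 1) / (2 * Real.pi)) atTop (cocompact ℝ) := by
    refine Tendsto.mono_right ?_ atTop_le_cocompact
    refine Tendsto.atTop_div_const (by positivity) ?_
    exact tendsto_atTop_add_const_right _ _
      (tendsto_natCast_atTop_atTop.const_mul_atTop (by norm_num))
  have h2 := (Complex.continuous_re.tendsto _).comp (h.comp hw)
  simp only [Complex.zero_re] at h2
  refine h2.congr fun N => ?_
  set w := (2 * (N : ℝ) + 1) / (2 * Real.pi) with hwd
  have hint : Integrable (fun v : ℝ => Real.fourierChar (-(v * w)) • (f v : ℂ)) :=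
    (Real.fourierIntegral_convergent_iff (μ := volume) (f := fun x => (f x : ℂ)) w).2
      hf.ofReal |>.congr
      (ae_of_all _ fun v => by simp [mul_comm])
  simp only [Function.comp]
  rw [← RCLike.re_eq_complex_re, ← integral_re hint]
  congr 1
  ext v
  rw [Circle.smul_def, Real.fourierChar_apply, RCLike.re_eq_complex_re, smul_eq_mul,
    Complex.re_mul_ofReal, Complex.exp_ofReal_mul_I_re, mul_comm, hwd]
  congr 1
  rw [← Real.cos_neg]
  congr 1
  field_simp

lemma sin_mul_sum_sin (N : ℕ) (x : ℝ) :
    Real.sin x * ∑ k ∈ Finset.range (N + 1), 2 * Real.sin (2 * k * x) =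
      Real.cos x - Real.cos ((2 * N + 1) * x) := by
  induction N with
  | zero => simp
  | succ N ih =>
    rw [Finset.sum_range_succ, mul_add, ih]
    push_cast
    have e1 : (2 * (N : ℝ) + 1) * x = 2 * (N + 1) * x - x := by ring
    have e2 : (2 * ((N : ℝ) + 1) + 1) * x = 2 * (N + 1) * x + x := by ring
    rw [e1, e2, Real.cos_sub, Real.cos_add]
    ring

/-- The function `x ↦ q (x / π)`. -/
noncomputable def scaledPoly (q : Polynomial ℚ) (x : ℝ) : ℝ := Polynomial.aeval (x / Real.pi) q

@[fun_prop]
lemma continuous_scaledPoly (q : Polynomial ℚ) : Continuous (scaledPoly q) := by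
  unfold scaledPoly
  exact (Polynomial.continuous_aeval q).comp (by fun_prop)

lemma hasDerivAt_scaledPoly (q : Polynomial ℚ) (x : ℝ) :
    HasDerivAt (scaledPoly q) (scaledPoly q.derivative x / Real.pi) x := by
  have h := (q.hasDerivAt_aeval (x / Real.pi)).comp x ((hasDerivAt_id x).div_const Real.pi)
  exact h.congr_deriv (by simp [scaledPoly]; ring)

lemma scaledPoly_zero (q : Polynomial ℚ) : scaledPoly q 0 = (q.eval 0 : ℚ) := by
  rw [scaledPoly, zero_div, show (0 : ℝ) = algebraMap ℚ ℝ 0 by simp,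
    Polynomial.aeval_algebraMap_apply_eq_algebraMap_eval]
  simp

lemma scaledPoly_pi_div_two (q : Polynomial ℚ) :
    scaledPoly q (Real.pi / 2) = (q.eval (1 / 2) : ℚ) := by
  have := Real.pi_ne_zero
  rw [scaledPoly, show Real.pi / 2 / Real.pi = algebraMap ℚ ℝ (1 / 2) by simp; field_simp,
    Polynomial.aeval_algebraMap_apply_eq_algebraMap_eval]
  simp

/-- Two integrations by parts; `sin 2kx` vanishes at both ends, so only the cosine boundary terms
remain. For `k = 0` both sides are zero by the convention on division. -/
lemma integral_scaledPoly_mul_sin (q : Polynomial ℚ) (k : ℕ) :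
    ∫ x in (0 : ℝ)..(Real.pi / 2), scaledPoly q x * Real.sin (2 * k * x) =
      ((q.eval 0 : ℚ) - (-1) ^ k * (q.eval (1 / 2) : ℚ) : ℝ) / (2 * k) -
      1 / (Real.pi ^ 2 * (2 * k) ^ 2) * ∫ x in (0 : ℝ)..(Real.pi / 2),
        scaledPoly q.derivative.derivative x * Real.sin (2 * k * x) := by
  rcases Nat.eq_zero_or_pos k with rfl | hk
  · simp
  have hpi := Real.pi_ne_zero
  have hk' : (k : ℝ) ≠ 0 := by positivity
  have h : ∀ x ∈ uIcc 0 (Real.pi / 2), HasDerivAt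
      (fun x : ℝ => scaledPoly q.derivative x * Real.sin (2 * k * x) / (Real.pi * (2 * k) ^ 2) -
        scaledPoly q x * Real.cos (2 * k * x) / (2 * k))
      (scaledPoly q x * Real.sin (2 * k * x) + 1 / (Real.pi ^ 2 * (2 * k) ^ 2) *
        (scaledPoly q.derivative.derivative x * Real.sin (2 * k * x))) x := by
    intro x _
    have hl : HasDerivAt (fun x : ℝ => 2 * (k : ℝ) * x) (2 * k) x := by
      simpa using (hasDerivAt_id x).const_mul (2 * (k : ℝ))
    refine ((((hasDerivAt_scaledPoly q.derivative x).mul hl.sin).div_const _).sub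
      (((hasDerivAt_scaledPoly q x).mul hl.cos).div_const _)).congr_deriv ?_
    field_simp
    ring
  have h2 := intervalIntegral.integral_eq_sub_of_hasDerivAt h
    (Continuous.intervalIntegrable (by fun_prop) _ _)
  rw [intervalIntegral.integral_add (Continuous.intervalIntegrable (by fun_prop) _ _)
    (Continuous.intervalIntegrable (by fun_prop) _ _), intervalIntegral.integral_const_mul] at h2
  have es : Real.sin (2 * k * (Real.pi / 2)) = 0 := by
    rw [show 2 * (k : ℝ) * (Real.pi / 2) = k * Real.pi by ring, Real.sin_nat_mul_pi]
  have ec : Real.cos (2 * k * (Real.pi / 2)) = (-1) ^ k := by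
    rw [show 2 * (k : ℝ) * (Real.pi / 2) = k * Real.pi by ring, Real.cos_nat_mul_pi]
  rw [eq_sub_iff_add_eq, h2, es, ec, scaledPoly_zero q, scaledPoly_pi_div_two q]
  simp
  ring

lemma integral_scaledPoly_mul_sin_eq_sum (R : ℕ) : ∀ (q : Polynomial ℚ) (k : ℕ),
    Polynomial.derivative^[2 * R] q = 0 →
    ∫ x in (0 : ℝ)..(Real.pi / 2), scaledPoly q x * Real.sin (2 * k * x) =
      ∑ r ∈ Finset.range R, (-1) ^ r / (Real.pi ^ (2 * r) * (2 * k) ^ (2 * r + 1)) *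
        (((Polynomial.derivative^[2 * r] q).eval 0 : ℚ) -
          (-1) ^ k * ((Polynomial.derivative^[2 * r] q).eval (1 / 2) : ℚ) : ℝ) := by
  induction R with
  | zero =>
    intro q k h
    simp only [mul_zero, Function.iterate_zero, id] at h
    simp [h, scaledPoly]
  | succ R ih =>
    intro q k h
    rw [integral_scaledPoly_mul_sin, ih q.derivative.derivative k h, Finset.sum_range_succ',
      Finset.mul_sum, sub_eq_neg_add, ← Finset.sum_neg_distrib]
    congr 1
    · refine Finset.sum_congr rfl fun r _ => ?_
      rw [show 2 * (r + 1) = 2 * r + 1 + 1 by ring, Function.iterate_succ_apply,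
        Function.iterate_succ_apply]
      rcases Nat.eq_zero_or_pos k with rfl | hk
      · simp
      have hk' : (k : ℝ) ≠ 0 := by positivity
      have hpi := Real.pi_ne_zero
      field_simp
      ring
    · simp
      ring

lemma integrableOn_scaledPoly_div_sin {q : Polynomial ℚ} (h0 : q.eval 0 = 0) :
    IntegrableOn (fun x => scaledPoly q x / Real.sin x) (Ioo 0 (Real.pi / 2)) := by
  have hpi := Real.pi_pos
  -- The zero of `q` at `0` cancels that of the sine: by Jordan's inequality `(x / π) / sin x ≤
  -- 1/2`.
  obtain ⟨r, rfl⟩ : Polynomial.X ∣ q := by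
    rwa [Polynomial.X_dvd_iff, Polynomial.coeff_zero_eq_eval_zero]
  obtain ⟨C, hC⟩ := (isCompact_Icc (a := 0) (b := Real.pi / 2)).exists_bound_of_continuousOn
    (continuous_scaledPoly r).continuousOn
  refine Measure.integrableOn_of_bounded (M := 1 / 2 * C) (by simp)
    (Measurable.aestronglyMeasurable (by fun_prop)) ?_
  refine (ae_restrict_iff' measurableSet_Ioo).2 (ae_of_all _ fun x hx => ?_)
  have hs : 0 < Real.sin x := Real.sin_pos_of_pos_of_lt_pi hx.1 (by linarith [hx.2])
  have e : scaledPoly (Polynomial.X * r) x / Real.sin x =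
      (x / Real.pi / Real.sin x) * scaledPoly r x := by
    simp [scaledPoly]; ring
  rw [e, norm_mul]
  refine mul_le_mul ?_ (hC x ⟨hx.1.le, hx.2.le⟩) (norm_nonneg _) (by norm_num)
  rw [Real.norm_of_nonneg (div_nonneg (div_nonneg hx.1.le hpi.le) hs.le), div_le_iff₀ hs]
  have := Real.mul_le_sin hx.1.le hx.2.le
  calc x / Real.pi = 1 / 2 * (2 / Real.pi * x) := by ring
    _ ≤ _ := by linarith

lemma integrableOn_scaledPoly_mul_cot {q : Polynomial ℚ} (h0 : q.eval 0 = 0) :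
    IntegrableOn (fun x => scaledPoly q x * (Real.cos x / Real.sin x)) (Ioo 0 (Real.pi / 2)) := by
  have := (integrableOn_scaledPoly_div_sin h0).mul_bdd (c := 1) (g := Real.cos)
    (Measurable.aestronglyMeasurable (by fun_prop)) (ae_of_all _ fun x => Real.abs_cos_le_one x)
  exact this.congr (ae_of_all _ fun x => by simp only; ring)

/-- By `sin_mul_sum_sin` the partial sums of `2 ∑ sin 2kx` equal `cot x - cos ((2N+1)x) / sin x`,
and the last term contributes `o(1)` by Riemann–Lebesgue. -/
lemma tendsto_sum_integral_scaledPoly_mul_sin {q : Polynomial ℚ} (h0 : q.eval 0 = 0) :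
    Tendsto (fun N : ℕ => ∑ k ∈ Finset.range (N + 1),
      2 * ∫ x in (0 : ℝ)..(Real.pi / 2), scaledPoly q x * Real.sin (2 * k * x)) atTop
      (𝓝 (∫ x in Ioo 0 (Real.pi / 2), scaledPoly q x * (Real.cos x / Real.sin x))) := by
  have hpi := Real.pi_pos
  have hi := integrableOn_scaledPoly_div_sin h0
  have h := tendsto_integral_mul_cos_odd (hi.integrable_indicator measurableSet_Ioo)
  have := h.const_sub (∫ x in Ioo 0 (Real.pi / 2), scaledPoly q x * (Real.cos x / Real.sin x))
  rw [sub_zero] at this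
  refine this.congr fun N => ?_
  have e : ∫ x, (Ioo 0 (Real.pi / 2)).indicator (fun x => scaledPoly q x / Real.sin x) x *
      Real.cos ((2 * N + 1) * x) =
      ∫ x in Ioo 0 (Real.pi / 2), scaledPoly q x / Real.sin x * Real.cos ((2 * N + 1) * x) := by
    rw [← integral_indicator measurableSet_Ioo]
    congr 1; ext x
    by_cases hx : x ∈ Ioo 0 (Real.pi / 2) <;> simp [hx]
  rw [e, ← integral_sub (integrableOn_scaledPoly_mul_cot h0)]
  · simp_rw [← intervalIntegral.integral_const_mul]
    rw [← intervalIntegral.integral_finsetSum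
      (fun k _ => Continuous.intervalIntegrable (by fun_prop) _ _),
      intervalIntegral.integral_of_le (by positivity), integral_Ioc_eq_integral_Ioo]
    refine setIntegral_congr_fun measurableSet_Ioo fun x hx => ?_
    have hs : Real.sin x ≠ 0 := (Real.sin_pos_of_pos_of_lt_pi hx.1 (by linarith [hx.2])).ne'
    have h1 := sin_mul_sum_sin N x
    have h2 : ∑ k ∈ Finset.range (N + 1), 2 * (scaledPoly q x * Real.sin (2 * k * x)) =
        scaledPoly q x * ∑ k ∈ Finset.range (N + 1), 2 * Real.sin (2 * k * x) := by
      rw [Finset.mul_sum]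
      exact Finset.sum_congr rfl fun k _ => by ring
    rw [h2]
    generalize ∑ k ∈ Finset.range (N + 1), 2 * Real.sin (2 * k * x) = S at h1 ⊢
    field_simp
    linear_combination (-scaledPoly q x) * h1
  · exact hi.mul_bdd (c := 1) (g := fun x => Real.cos ((2 * N + 1) * x))
      (Measurable.aestronglyMeasurable (by fun_prop)) (ae_of_all _ fun x => Real.abs_cos_le_one _)

lemma hasSum_neg_one_pow_div_pow {s : ℕ} (hs : 1 < s) :
    HasSum (fun k : ℕ => (-1 : ℝ) ^ k * (1 / (k : ℝ) ^ s))
      ((2 / 2 ^ s - 1) * ∑' k : ℕ, 1 / (k : ℝ) ^ s) := by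
  have hZ := Real.summable_one_div_nat_pow.2 hs
  set f : ℕ → ℝ := fun k => 1 / (k : ℝ) ^ s with hf
  have he : HasSum (fun k => f (2 * k)) (1 / 2 ^ s * ∑' k, f k) := by
    refine (hZ.hasSum.mul_left (1 / 2 ^ s)).congr_fun fun k => ?_
    simp [hf, mul_pow, mul_comm]
  have ho : HasSum (fun k => f (2 * k + 1)) ((1 - 1 / 2 ^ s) * ∑' k, f k) := by
    have so : Summable (fun k => f (2 * k + 1)) :=
      hZ.comp_injective (i := fun k : ℕ => 2 * k + 1) fun a b h => by simp only at h; omega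
    have := (he.even_add_odd so.hasSum).unique hZ.hasSum
    have h3 := so.hasSum
    rwa [show ∑' k, f (2 * k + 1) = (1 - 1 / 2 ^ s) * ∑' k, f k by
      simp only [f] at this ⊢; linarith] at h3
  have := HasSum.even_add_odd (f := fun k : ℕ => (-1 : ℝ) ^ k * f k)
    (he.congr_fun fun k => by simp) (ho.neg.congr_fun fun k => by simp [pow_succ])
  convert this using 1
  ring

/-- Cotangent integrals of polynomials that vanish at both ends are rational combinations of odd
zeta values over powers of `π`. -/
lemma exists_integral_scaledPoly_mul_cot {q : Polynomial ℚ} (h0 : q.eval 0 = 0)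
    (h1 : q.eval (1 / 2) = 0) {R : ℕ} (hR : q.natDegree < 2 * (R + 1)) :
    ∃ c : ℕ → ℚ, ∫ x in Ioo 0 (Real.pi / 2), scaledPoly q x * (Real.cos x / Real.sin x) =
      ∑ r ∈ Finset.range R,
        (c r : ℝ) / Real.pi ^ (2 * r + 2) * ∑' k : ℕ, 1 / (k : ℝ) ^ (2 * r + 3) := by
  have hpi := Real.pi_ne_zero
  set a : ℕ → ℚ := fun r => (Polynomial.derivative^[2 * (r + 1)] q).eval 0
  set b : ℕ → ℚ := fun r => (Polynomial.derivative^[2 * (r + 1)] q).eval (1 / 2)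
  -- The factor `2 / 2^s - 1`, with `s = 2r+3`, converts the alternating sum coming from the
  -- endpoint `π/2` into `ζ(s)`.
  refine ⟨fun r => 2 * (-1) ^ (r + 1) / 2 ^ (2 * r + 3) * (a r - b r * (2 / 2 ^ (2 * r + 3) - 1)),
    ?_⟩
  have hJ : ∀ k : ℕ, 2 * ∫ x in (0 : ℝ)..(Real.pi / 2), scaledPoly q x * Real.sin (2 * k * x) =
      ∑ r ∈ Finset.range R, 2 * (-1) ^ (r + 1) / 2 ^ (2 * r + 3) / Real.pi ^ (2 * r + 2) *
        (a r * (1 / (k : ℝ) ^ (2 * r + 3)) -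
          b r * ((-1) ^ k * (1 / (k : ℝ) ^ (2 * r + 3)))) := by
    intro k
    rw [integral_scaledPoly_mul_sin_eq_sum (R + 1) q k
      (Polynomial.iterate_derivative_eq_zero hR), Finset.sum_range_succ', mul_add, Finset.mul_sum]
    -- The zeros of `q` at `0` and `1/2` remove the `1/k` term, so every remaining series converges
    -- absolutely.
    simp only [mul_zero, Function.iterate_zero, id, h0, h1, Rat.cast_zero, sub_zero, add_zero]
    refine Finset.sum_congr rfl fun r _ => ?_
    rw [show 2 * (r + 1) + 1 = 2 * r + 3 by ring, show 2 * r + 2 = 2 * (r + 1) by ring, mul_pow]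
    rcases Nat.eq_zero_or_pos k with rfl | hk
    · simp
    have hk' : (k : ℝ) ≠ 0 := by positivity
    simp only [a, b]
    field_simp
  refine tendsto_nhds_unique (tendsto_sum_integral_scaledPoly_mul_sin h0) ?_
  simp_rw [hJ]
  have hS : HasSum (fun k : ℕ =>
      ∑ r ∈ Finset.range R, 2 * (-1) ^ (r + 1) / 2 ^ (2 * r + 3) / Real.pi ^ (2 * r + 2) *
        (a r * (1 / (k : ℝ) ^ (2 * r + 3)) - b r * ((-1) ^ k * (1 / (k : ℝ) ^ (2 * r + 3)))))
      (∑ r ∈ Finset.range R, 2 * (-1) ^ (r + 1) / 2 ^ (2 * r + 3) / Real.pi ^ (2 * r + 2) *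
        (a r * (∑' k : ℕ, 1 / (k : ℝ) ^ (2 * r + 3)) -
          b r * ((2 / 2 ^ (2 * r + 3) - 1) * ∑' k : ℕ, 1 / (k : ℝ) ^ (2 * r + 3)))) :=
    hasSum_sum fun r _ =>
      (((Real.summable_one_div_nat_pow.2 (by omega)).hasSum.mul_left _).sub
        ((hasSum_neg_one_pow_div_pow (by omega)).mul_left _)).mul_left _
  have hT := (tendsto_add_atTop_iff_nat 1).2 hS.tendsto_sum_nat
  refine (hT.congr fun N => rfl).trans (le_of_eq ?_)
  congr 1
  refine Finset.sum_congr rfl fun r _ => ?_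
  push_cast
  ring

/-- The integrals of `x ^ m / m!` against the cotangent weight. -/
lemma exists_lintegral_pow_mul_cotWeight (n e : ℕ) (he : e ≤ 1) :
    ∃ c : ℕ → ℚ,
      ∫⁻ x in Ioo 0 (Real.pi / 2),
        ENNReal.ofReal (x ^ (2 * n + (e + 1)) / (2 * n + (e + 1)).factorial) *
          ENNReal.ofReal (cotWeight x) =
      ENNReal.ofReal (Real.pi ^ e * ∑ r ∈ Finset.range (n + 1),
        (c r : ℝ) * Real.pi ^ (2 * (n - r)) * ∑' k : ℕ, 1 / (k : ℝ) ^ (2 * r + 3)) := by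
  have hpi := Real.pi_ne_zero
  have hpi0 := Real.pi_pos
  set m := 2 * n + (e + 1) with hm
  -- In the variable `x / π` the integrand has rational coefficients; rescaling costs `π ^ (m+1)`.
  set q : Polynomial ℚ := Polynomial.C (1 / (m.factorial : ℚ)) *
    (Polynomial.X ^ m * (Polynomial.C (1 / 2) - Polynomial.X)) with hq
  have h0 : q.eval 0 = 0 := by simp [hq, hm]
  have h1 : q.eval (1 / 2) = 0 := by simp [hq]
  have hd : q.natDegree < 2 * (n + 1 + 1) := by
    have : q.natDegree ≤ 0 + (m + 1) := by
      rw [hq]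
      refine Polynomial.natDegree_mul_le_of_le (by simp)
        (Polynomial.natDegree_mul_le_of_le (by simp) ?_)
      exact (Polynomial.natDegree_sub_le _ _).trans (by simp)
    omega
  have hF : ∀ x, scaledPoly q x * (Real.cos x / Real.sin x) * Real.pi ^ (m + 1) =
      x ^ m / m.factorial * cotWeight x := by
    intro x
    simp only [scaledPoly, hq, cotWeight]
    simp only [map_mul, map_pow, map_sub, Polynomial.aeval_C, Polynomial.aeval_X, div_pow, pow_succ]
    simp
    field_simp
  obtain ⟨c, hc⟩ := exists_integral_scaledPoly_mul_cot h0 h1 hd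
  refine ⟨c, ?_⟩
  have hnn : ∀ x ∈ Ioo 0 (Real.pi / 2), 0 ≤ x ^ m / m.factorial * cotWeight x := fun x hx =>
    mul_nonneg (div_nonneg (pow_nonneg hx.1.le _) (by positivity)) (cotWeight_nonneg hx)
  have hi : IntegrableOn (fun x => x ^ m / m.factorial * cotWeight x) (Ioo 0 (Real.pi / 2)) := by
    simp_rw [← hF]
    exact (integrableOn_scaledPoly_mul_cot h0).mul_const _
  calc _ = ∫⁻ x in Ioo 0 (Real.pi / 2), ENNReal.ofReal (x ^ m / m.factorial * cotWeight x) :=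
        setLIntegral_congr_fun measurableSet_Ioo fun x hx =>
          (ENNReal.ofReal_mul (div_nonneg (pow_nonneg hx.1.le _) (by positivity))).symm
    _ = _ := by
        rw [lintegral_Ioo_eq_intervalIntegral (by positivity) hi hnn,
          intervalIntegral.integral_of_le (by positivity), integral_Ioc_eq_integral_Ioo]
        simp_rw [← hF]
        rw [integral_mul_const, hc, Finset.sum_mul, Finset.mul_sum]
        congr 1
        refine Finset.sum_congr rfl fun r hr => ?_
        have hr' : r ≤ n := Nat.lt_succ_iff.1 (Finset.mem_range.1 hr)
        rw [show m + 1 = e + 2 * (n - r) + (2 * r + 2) by omega, pow_add _ (e + _), pow_add _ e]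
        field_simp

/-! ### From multi-indices to chain sums -/

-- The free weight `f` on the leading entry drives the induction: the tail is summed with the
-- indicator of `q < p`. Later `f` is the extra reciprocal that makes the first exponent `3`.
open Classical in
lemma tsum_strictAnti_eq_tsum_chainSum (g : ℕ → ℝ≥0∞) (n : ℕ) : ∀ f : ℕ → ℝ≥0∞,
    ∑' m : Fin (n + 1) → ℕ, (if StrictAnti m then f (m 0) * ∏ j, g (m j) else 0) =
      ∑' p, f p * chainSum g n p := by
  induction n with
  | zero =>
    intro f
    rw [← (Equiv.funUnique (Fin 1) ℕ).symm.tsum_eq]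
    refine tsum_congr fun p => ?_
    have h : StrictAnti ((Equiv.funUnique (Fin 1) ℕ).symm p) := fun a b hab => by omega
    rw [if_pos h]
    simp [chainSum]
  | succ n ih =>
    intro f
    rw [← (Fin.consEquiv fun _ : Fin (n + 2) => ℕ).tsum_eq, ENNReal.tsum_prod']
    refine tsum_congr fun p => ?_
    calc _ = ∑' m : Fin (n + 1) → ℕ, f p * g p *
          (if StrictAnti m then (if m 0 < p then 1 else 0) * ∏ j, g (m j) else 0) := by
          refine tsum_congr fun m => ?_
          have : StrictAnti (Fin.consEquiv (fun _ : Fin (n + 2) => ℕ) (p, m)) ↔ m 0 < p ∧ StrictAnti m :=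
            strictAnti_vecCons
          simp only [this]
          simp only [Fin.consEquiv_apply, Fin.cons_zero, Fin.prod_univ_succ (n := n + 1),
            Fin.cons_succ]
          by_cases h1 : m 0 < p <;> by_cases h2 : StrictAnti m <;> simp [h1, h2, mul_assoc]
      _ = _ := by
          rw [ENNReal.tsum_mul_left, ih fun q => if q < p then 1 else 0, chainSum, mul_assoc]
          congr 2
          exact tsum_congr fun q => by split_ifs <;> simp

lemma multipleTerm_threeTwos (n : ℕ) (v : Fin (n + 1) → ℕ) :
    multipleTerm (threeTwos n) v = 1 / (v 0 : ℝ) * ∏ j, (1 / (v j : ℝ) ^ 2) := by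
  rw [multipleTerm, Fin.prod_univ_succ, Fin.prod_univ_succ]
  simp only [threeTwos, Fin.cons_zero, Fin.cons_succ]
  rw [Finset.prod_div_distrib, Finset.prod_const_one, div_mul_div_comm, one_mul, div_mul_div_comm,
    one_mul, ← mul_assoc, ← pow_succ']

lemma multipleTerm_nonneg {k : ℕ} (i n : Fin k → ℕ) : 0 ≤ multipleTerm i n := by
  unfold multipleTerm; positivity

open Classical in
lemma tsum_strictAnti_multipleTerm (ε n : ℕ) :
    ∑' m : Fin (n + 1) → ℕ, (if StrictAnti m then
      ENNReal.ofReal (multipleTerm (threeTwos n) fun j => 2 * m j + ε) else 0) =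
    ∑' p, ENNReal.ofReal (1 / ((2 * p + ε : ℕ) : ℝ)) * chainSum (invSq ε) n p := by
  rw [← tsum_strictAnti_eq_tsum_chainSum]
  refine tsum_congr fun m => ?_
  congr 1
  rw [multipleTerm_threeTwos, ENNReal.ofReal_mul (by positivity),
    ENNReal.ofReal_prod_of_nonneg (fun j _ => by positivity)]
  rfl

lemma multipleTerm_threeTwos_two_mul (n : ℕ) (m : Fin (n + 1) → ℕ) :
    multipleTerm (threeTwos n) (fun j => 2 * m j + 0) =
      multipleTerm (threeTwos n) m / 2 ^ (2 * n + 3) := by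
  have : ∀ j, 1 / ((2 * m j + 0 : ℕ) : ℝ) ^ 2 = 1 / 2 ^ 2 * (1 / (m j : ℝ) ^ 2) := fun j => by
    push_cast
    rw [add_zero, mul_pow, div_mul_div_comm, one_mul]
  rw [multipleTerm_threeTwos, multipleTerm_threeTwos, Finset.prod_congr rfl fun j _ => this j,
    Finset.prod_mul_distrib, Finset.prod_const, Finset.card_fin, div_pow, one_pow, ← pow_mul,
    show 2 * n + 3 = 2 * (n + 1) + 1 by ring, pow_succ]
  push_cast
  rw [add_zero, one_div_mul_eq_div, mul_comm 2, ← div_div, ← div_div]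
  ring

open Classical in
lemma tsum_zetaRange (n : ℕ) :
    ∑' m : zetaRange (n + 1), ENNReal.ofReal (multipleTerm (threeTwos n) m / 2 ^ (2 * n + 3)) =
    ∑' m : Fin (n + 1) → ℕ, (if StrictAnti m then
      ENNReal.ofReal (multipleTerm (threeTwos n) fun j => 2 * m j + 0) else 0) := by
  rw [tsum_subtype (zetaRange (n + 1))
    fun m => ENNReal.ofReal (multipleTerm (threeTwos n) m / 2 ^ (2 * n + 3))]
  refine tsum_congr fun m => ?_
  rw [multipleTerm_threeTwos_two_mul, indicator_apply]
  by_cases h1 : StrictAnti m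
  · by_cases h2 : ∀ j, 0 < m j
    · rw [if_pos (show m ∈ zetaRange (n + 1) from ⟨h1, h2⟩), if_pos h1]
    · rw [if_neg (fun h => h2 h.2), if_pos h1]
      push Not at h2
      obtain ⟨j, hj⟩ := h2
      -- Chains containing `0` are harmless, since `1 / 0 = 0` kills their term.
      have : ∏ j, (1 / (m j : ℝ) ^ 2) = 0 :=
        Finset.prod_eq_zero (Finset.mem_univ j) (by simp [Nat.le_zero.1 hj])
      rw [multipleTerm_threeTwos, this]
      simp
  · rw [if_neg (fun h => h1 h.1), if_neg h1]

open Classical in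
lemma tsum_tRange (n : ℕ) :
    ∑' m : tRange (n + 1), ENNReal.ofReal (multipleTerm (threeTwos n) m) =
    ∑' m : Fin (n + 1) → ℕ, (if StrictAnti m then
      ENNReal.ofReal (multipleTerm (threeTwos n) fun j => 2 * m j + 1) else 0) := by
  rw [tsum_subtype (tRange (n + 1)) fun m => ENNReal.ofReal (multipleTerm (threeTwos n) m)]
  have inj : Function.Injective fun (m : Fin (n + 1) → ℕ) j => 2 * m j + 1 := fun a b h => by
    ext j
    have := congrFun h j
    simp only at this
    omega
  rw [← inj.tsum_eq]
  · refine tsum_congr fun m => ?_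
    have : (fun j => 2 * m j + 1) ∈ tRange (n + 1) ↔ StrictAnti m := by
      constructor
      · intro h a b hab
        have := h.1 hab
        simp only at this
        omega
      · exact fun h => ⟨fun a b hab => by have := h hab; simp only; omega,
          fun j => odd_two_mul_add_one _⟩
    rw [indicator_apply]
    simp only [this]
  · intro m hm
    have h : m ∈ tRange (n + 1) := (indicator_apply_ne_zero.1 hm).1
    choose a ha using h.2
    exact ⟨a, funext fun j => (ha j).symm⟩

/-- The maximum avoids proving `0 ≤ C`: the target is a submodule, which also contains `0`. -/
lemma summable_and_tsum_of_tsum_ofReal {α : Type*} {F : α → ℝ} (hF : ∀ a, 0 ≤ F a) {C : ℝ}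
    (h : ∑' a, ENNReal.ofReal (F a) = ENNReal.ofReal C) :
    Summable F ∧ ∑' a, F a = max C 0 := by
  have hs := ENNReal.summable_toReal (f := fun a => ENNReal.ofReal (F a)) (by simp [h])
  simp only [ENNReal.toReal_ofReal (hF _)] at hs
  refine ⟨hs, ?_⟩
  have := congrArg ENNReal.toReal h
  rw [ENNReal.tsum_toReal_eq (by simp)] at this
  simpa only [ENNReal.toReal_ofReal (hF _), ENNReal.toReal_ofReal'] using this

/-! ### Homogeneity and conclusion -/

/-- The combinations of `π ^ (2 (n - r)) ζ(2 r + 3)` for `r ≤ n`. -/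
noncomputable def piZetaSum (n : ℕ) (c : ℕ → ℚ) : ℝ :=
  ∑ r ∈ Finset.range (n + 1),
    (c r : ℝ) * Real.pi ^ (2 * (n - r)) * ∑' k : ℕ, 1 / (k : ℝ) ^ (2 * r + 3)

lemma piZetaSum_mem (n : ℕ) (c : ℕ → ℚ) :
    ((piZetaSum n c : ℝ) : ℂ) ∈ piOddZetaPart (n + 1) (2 * n + 3) := by
  rw [piZetaSum, Complex.ofReal_sum]
  refine Submodule.sum_mem _ fun r hr => ?_
  have hr' : r < n + 1 := Finset.mem_range.1 hr
  set j : Fin (n + 1 + 1) := ⟨r + 1, by omega⟩ with hj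
  -- The degree is `2(n - r) + (2r + 3) = 2n + 3`.
  refine Submodule.mem_map.2 ⟨MvPolynomial.C (c r) * (MvPolynomial.X 0 ^ (2 * (n - r)) *
    MvPolynomial.X j), ?_, ?_⟩
  · rw [MvPolynomial.mem_weightedHomogeneousSubmodule]
    have h := (MvPolynomial.isWeightedHomogeneous_C (piOddZetaDegree (n + 1)) (c r)).mul
      (((MvPolynomial.isWeightedHomogeneous_X ℚ (piOddZetaDegree (n + 1)) 0).pow (2 * (n - r))).mul
        (MvPolynomial.isWeightedHomogeneous_X ℚ (piOddZetaDegree (n + 1)) j))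
    convert h using 1
    simp [piOddZetaDegree, hj]
    omega
  · have hz : riemannZeta (2 * ((r + 1 : ℕ) : ℂ) + 1) =
        ((∑' k : ℕ, 1 / (k : ℝ) ^ (2 * r + 3) : ℝ) : ℂ) := by
      have := zeta_nat_eq_tsum_of_gt_one (k := 2 * r + 3) (by omega)
      rw [Complex.ofReal_tsum]
      push_cast at this ⊢
      rw [← this]
      congr 1
      ring
    have hj0 : j ≠ 0 := by simp [hj, Fin.ext_iff]
    simp only [AlgHom.toLinearMap_apply, map_mul, map_pow, MvPolynomial.aeval_C,
      MvPolynomial.aeval_X, piOddZeta, if_neg hj0, if_true]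
    rw [hz]
    simp
    ring

lemma max_piZetaSum_mem (n : ℕ) (c : ℕ → ℚ) :
    ((max (piZetaSum n c) 0 : ℝ) : ℂ) ∈ piOddZetaPart (n + 1) (2 * n + 3) := by
  rcases max_choice (piZetaSum n c) 0 with h | h <;> rw [h]
  · exact piZetaSum_mem n c
  · simp

lemma exists_tsum_zetaRange (n : ℕ) : ∃ c : ℕ → ℚ,
    ∑' m : zetaRange (n + 1), ENNReal.ofReal (multipleTerm (threeTwos n) m / 2 ^ (2 * n + 3)) =
      ENNReal.ofReal (piZetaSum n c) := by
  have hpi := Real.pi_pos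
  obtain ⟨c, hc⟩ := exists_lintegral_pow_mul_cotWeight n 1 le_rfl
  have h00 : chainSum (invSq 0) n 0 = 0 := by cases n <;> simp [chainSum, invSq]
  have h := tsum_chainSum_div (ε := 0) (d := 2) (c := Real.pi / 2) (by positivity)
    (by simp [sinPow, sinWeight]) tsum_invSq_zero n (Or.inl h00)
  rw [hc, ← tsum_strictAnti_multipleTerm, ← tsum_zetaRange] at h
  -- The integral carries a factor `π` and the series a factor `π/2`; cancelling them doubles the
  -- coefficients.
  refine ⟨fun r => 2 * c r, ?_⟩
  have e : Real.pi ^ 1 * piZetaSum n c = Real.pi / 2 * piZetaSum n fun r => 2 * c r := by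
    simp only [piZetaSum, Finset.mul_sum]
    refine Finset.sum_congr rfl fun r _ => ?_
    push_cast
    ring
  rw [← piZetaSum, e, ENNReal.ofReal_mul (by positivity)] at h
  exact (ENNReal.mul_right_inj (by simpa using hpi) ENNReal.ofReal_ne_top).1 h

lemma exists_tsum_tRange (n : ℕ) : ∃ c : ℕ → ℚ,
    ∑' m : tRange (n + 1), ENNReal.ofReal (multipleTerm (threeTwos n) m) =
      ENNReal.ofReal (piZetaSum n c) := by
  obtain ⟨c, hc⟩ := exists_lintegral_pow_mul_cotWeight n 0 zero_le_one
  have h := tsum_chainSum_div (ε := 1) (d := 1) (c := 1) zero_le_one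
    (by simp [sinPow, sinWeight]) tsum_invSq_one n (Or.inr one_ne_zero)
  rw [hc, ← tsum_strictAnti_multipleTerm, ← tsum_tRange, ← piZetaSum] at h
  exact ⟨c, by simpa using h⟩

theorem mainTheorem5 (n : ℕ) :
    (Summable (fun m : zetaRange (n + 1) => multipleTerm (threeTwos n) m) ∧
      ((multipleZeta (threeTwos n) / 2 ^ (2 * n + 3) : ℝ) : ℂ) ∈
        piOddZetaPart (n + 1) (2 * n + 3)) ∧
    (Summable (fun m : tRange (n + 1) => multipleTerm (threeTwos n) m) ∧
      ((multipleT (threeTwos n) : ℝ) : ℂ) ∈ piOddZetaPart (n + 1) (2 * n + 3)) := by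
  obtain ⟨c, hc⟩ := exists_tsum_zetaRange n
  obtain ⟨c', hc'⟩ := exists_tsum_tRange n
  obtain ⟨hs, ht⟩ := summable_and_tsum_of_tsum_ofReal
    (fun m => div_nonneg (multipleTerm_nonneg _ _) (by positivity)) hc
  obtain ⟨hs', ht'⟩ := summable_and_tsum_of_tsum_ofReal (fun m => multipleTerm_nonneg _ _) hc'
  refine ⟨⟨(summable_div_const_iff (by positivity)).1 hs, ?_⟩, hs', ?_⟩
  · rw [multipleZeta, ← tsum_div_const, ht]
    exact max_piZetaSum_mem n c
  · rw [multipleT, ht']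
    exact max_piZetaSum_mem n c'
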